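/- Let $U$ be a real analytic Banach Lie group (a group that is a real analytic manifold modelled on a real Banach space, with analytic multiplication and inversion), equipped with a metric $d$ inducing its topology, and let $G\le U$ be a compact subgroup. For $\varepsilon>0$ write $G_\varepsilon=\{x\in U : d(x,G)<\varepsilon\}$ for the $\varepsilon$-neighbourhood of $G$. Then there is an $\varepsilon_0>0$, depending only on $U$, $d$ and $G$, such that for every $0<\varepsilon\le\varepsilon_0$, every discrete closed subgroup $K\le U$ with $K\subseteq G_\varepsilon$ is finite. -/

import Mathlib

open scoped Manifold ContDiff

open Filter Topology

/-! By compactness `G` lies in finitely many translates of a small neighbourhood `V` of 1, and so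
does a thin thickening of `G`; `LieGroup.exists_nhds_finite_of_discrete` then applies to `K`. Let `S
k` be the part of `K` of size at most `ρ / 2 ^ k` in a chart. Discreteness makes `S k` finite for
large `k`, and finiteness descends from `S (k + 1)` to `S k`: colour `u` by the translate containing
`u ^ 2 ^ k`. For equal colours these powers are close; since the power map expands distances by
about `2 ^ k` (`two_pow_mul_norm_sub_le`), `u⁻¹ * v` lies in `S (k + 1)`. Colouring `K` itself in
the same way reduces it to `S 0`. -/

/-! ### Local estimates for the group law. -/

/-- A `C²` map with vanishing derivative at the origin has Lipschitz constant `O(t)` on the ball of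
radius `t`. -/
lemma ContDiffAt.exists_norm_sub_le_mul_of_fderiv_eq_zero
    {E F : Type*} [NormedAddCommGroup E] [NormedSpace ℝ E] [NormedAddCommGroup F]
    [NormedSpace ℝ F] {g : E → F} (hg : ContDiffAt ℝ 2 g 0) (h0 : fderiv ℝ g 0 = 0) :
    ∃ C ρ : ℝ, 0 < C ∧ 0 < ρ ∧ ∀ t ≤ ρ, ∀ x y : E, ‖x‖ ≤ t → ‖y‖ ≤ t →
      ‖g x - g y‖ ≤ C * t * ‖x - y‖ := by
  have h1 : ContDiffAt ℝ 1 (fderiv ℝ g) 0 := hg.fderiv_right (by norm_num)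
  obtain ⟨K, s, hs, hK⟩ := h1.exists_lipschitzOnWith
  have hd : ∀ᶠ x in 𝓝 (0 : E), DifferentiableAt ℝ g x :=
    (hg.eventually (by simp)).mono fun x hx => hx.differentiableAt (by norm_num)
  obtain ⟨r, hr, hball⟩ := Metric.eventually_nhds_iff_ball.1 (hd.and hs)
  refine ⟨K + 1, r / 2, by positivity, by positivity, fun t ht x y hx hy => ?_⟩
  have hmem : ∀ z ∈ Metric.closedBall (0 : E) t, z ∈ Metric.ball (0 : E) r := fun z hz =>
    Metric.closedBall_subset_ball (by linarith) hz
  have ht0 : 0 ≤ t := (norm_nonneg x).trans hx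
  refine (convex_closedBall (0 : E) t).norm_image_sub_le_of_norm_fderiv_le (𝕜 := ℝ)
    (fun z hz => (hball z (hmem z hz)).1) (fun z hz => ?_) (by simpa using hy) (by simpa using hx)
  have := hK.norm_sub_le (hball z (hmem z hz)).2 (hball 0 (Metric.mem_ball_self hr)).2
  rw [h0, sub_zero, sub_zero] at this
  have hz' : ‖z‖ ≤ t := by simpa using hz
  have hK0 : (0 : ℝ) ≤ K := K.2
  nlinarith [norm_nonneg z]

/-- Quantitative form of the group law of a Banach Lie group in a chart around the identity. -/
lemma LieGroup.exists_chart_estimates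
    {E : Type*} [NormedAddCommGroup E] [NormedSpace ℝ E]
    {U : Type*} [Group U] [TopologicalSpace U] [ChartedSpace E U] [LieGroup 𝓘(ℝ, E) 2 U] :
    ∃ (N : U → E) (W : Set U) (ρ C : ℝ), 0 < ρ ∧ 0 < C ∧ N 1 = 0 ∧ 1 ∈ W ∧
      (∀ V ∈ 𝓝 (1 : U), ∃ t > 0, ∀ u ∈ W, ‖N u‖ ≤ t → u ∈ V) ∧
      (∀ t > 0, {u | u ∈ W ∧ ‖N u‖ ≤ t} ∈ 𝓝 (1 : U)) ∧
      (∀ u ∈ W, ∀ v ∈ W, ‖N u‖ ≤ ρ → ‖N v‖ ≤ ρ →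
        u * v ∈ W ∧ u⁻¹ * v ∈ W ∧ ‖N (u⁻¹ * v)‖ ≤ C * ‖N u - N v‖ ∧
          ‖N (u * v) - N u‖ ≤ C * ‖N v‖) ∧
      (∀ t ≤ ρ, ∀ u ∈ W, ∀ v ∈ W, ‖N u‖ ≤ t → ‖N v‖ ≤ t →
        ‖N (u * u) - N (v * v) - (2 : ℝ) • (N u - N v)‖ ≤ C * t * ‖N u - N v‖) := by
  have : IsTopologicalGroup U := topologicalGroup_of_lieGroup 𝓘(ℝ, E) 2
  have : IsManifold 𝓘(ℝ, E) 2 U := inferInstance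
  set e := chartAt E (1 : U) with he
  have h1s : (1 : U) ∈ e.source := mem_chart_source E 1
  set N : U → E := fun u => e u - e 1 with hN
  set ψ : E → U := fun x => e.symm (x + e 1) with hψ
  have hN1 : N 1 = 0 := by simp [hN]
  have hψ0 : ψ 0 = 1 := by simp [hψ, h1s]
  have hψN : ∀ u ∈ e.source, ψ (N u) = u := fun u hu => by simp [hψ, hN, hu]
  have hNc : ContinuousAt N 1 := (e.continuousAt h1s).sub continuousAt_const
  have hψs : ContMDiffAt 𝓘(ℝ, E) 𝓘(ℝ, E) 2 ψ 0 := by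
    have h2 : ContMDiffAt 𝓘(ℝ, E) 𝓘(ℝ, E) 2 e.symm (0 + e 1) :=
      (contMDiffOn_chart_symm (x := (1 : U))).contMDiffAt
        (e.open_target.mem_nhds (by simpa using e.map_source h1s))
    exact h2.comp (0 : E) (contDiff_id.add contDiff_const).contMDiff.contMDiffAt
  have hNs : ContMDiffAt 𝓘(ℝ, E) 𝓘(ℝ, E) 2 N 1 := by
    have h2 : ContMDiffAt 𝓘(ℝ, E) 𝓘(ℝ, E) 2 e 1 :=
      contMDiffOn_chart.contMDiffAt (e.open_source.mem_nhds h1s)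
    have h3 : ContMDiff 𝓘(ℝ, E) 𝓘(ℝ, E) 2 (fun x : E => x - e 1) :=
      (contDiff_id.sub contDiff_const).contMDiff
    exact (h3.contMDiffAt (x := e 1)).comp (1 : U) h2
  have hψ1 : ContMDiffAt 𝓘(ℝ, E × E) 𝓘(ℝ, E) 2 (fun p : E × E => ψ p.1) 0 :=
    ContMDiffAt.comp (0 : E × E) (g := ψ) (f := Prod.fst) hψs contDiff_fst.contMDiff.contMDiffAt
  have hψ2 : ContMDiffAt 𝓘(ℝ, E × E) 𝓘(ℝ, E) 2 (fun p : E × E => ψ p.2) 0 :=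
    ContMDiffAt.comp (0 : E × E) (g := ψ) (f := Prod.snd) hψs contDiff_snd.contMDiff.contMDiffAt
  have hF : ContDiffAt ℝ 2 (fun p : E × E => N (ψ p.1 * ψ p.2)) 0 := by
    rw [← contMDiffAt_iff_contDiffAt]
    refine ContMDiffAt.comp (0 : E × E) (g := N) (f := fun p : E × E => ψ p.1 * ψ p.2) ?_
      (hψ1.mul hψ2)
    simpa [hψ0] using hNs
  have hH : ContDiffAt ℝ 2 (fun p : E × E => N ((ψ p.1)⁻¹ * ψ p.2)) 0 := by
    rw [← contMDiffAt_iff_contDiffAt]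
    refine ContMDiffAt.comp (0 : E × E) (g := N) (f := fun p : E × E => (ψ p.1)⁻¹ * ψ p.2) ?_
      (hψ1.inv.mul hψ2)
    simpa [hψ0] using hNs
  obtain ⟨KF, sF, hsF, hKF⟩ := (hF.of_le (by norm_num)).exists_lipschitzOnWith
  obtain ⟨KH, sH, hsH, hKH⟩ := (hH.of_le (by norm_num)).exists_lipschitzOnWith
  have hNψ : ∀ᶠ x in 𝓝 (0 : E), N (ψ x) = x := by
    have : ∀ᶠ x in 𝓝 (0 : E), x + e 1 ∈ e.target := by
      refine ContinuousAt.eventually_mem (f := fun x : E => x + e 1) (by fun_prop) ?_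
      exact e.open_target.mem_nhds (by simpa using e.map_source h1s)
    filter_upwards [this] with x hx
    simp [hN, hψ, e.right_inv hx]
  have hq : ContDiffAt ℝ 2 (fun x : E => N (ψ x * ψ x) - (2 : ℝ) • x) 0 :=
    (ContDiffAt.comp (0 : E) (g := fun p : E × E => N (ψ p.1 * ψ p.2)) (f := fun x : E => (x, x))
      hF (contDiff_id.prodMk contDiff_id).contDiffAt).sub (contDiff_const_smul _).contDiffAt
  -- The derivative of multiplication at the identity is `(x, y) ↦ x + y`, as 1 is neutral on both
  -- sides.
  have hq' : fderiv ℝ (fun x : E => N (ψ x * ψ x) - (2 : ℝ) • x) 0 = 0 := by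
    obtain ⟨L, hL⟩ : ∃ L, HasFDerivAt (fun p : E × E => N (ψ p.1 * ψ p.2)) L (0 : E × E) :=
      ⟨_, (hF.differentiableAt (by norm_num)).hasFDerivAt⟩
    have hl : HasFDerivAt (fun x : E => N (ψ x * ψ 0)) (L.comp (.inl ℝ E E)) 0 :=
      HasFDerivAt.comp (0 : E) (g := fun p : E × E => N (ψ p.1 * ψ p.2))
        (f := fun x : E => (x, (0 : E))) hL (hasFDerivAt_prodMk_left 0 0)
    have hr : HasFDerivAt (fun x : E => N (ψ 0 * ψ x)) (L.comp (.inr ℝ E E)) 0 :=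
      HasFDerivAt.comp (0 : E) (g := fun p : E × E => N (ψ p.1 * ψ p.2))
        (f := fun x : E => ((0 : E), x)) hL (hasFDerivAt_prodMk_right 0 0)
    have hl' := hl.unique ((hasFDerivAt_id (𝕜 := ℝ) (0 : E)).congr_of_eventuallyEq
      (hNψ.mono fun x hx => by simp [hψ0, hx]))
    have hr' := hr.unique ((hasFDerivAt_id (𝕜 := ℝ) (0 : E)).congr_of_eventuallyEq
      (hNψ.mono fun x hx => by simp [hψ0, hx]))
    have hd : HasFDerivAt (fun x : E => N (ψ x * ψ x) - (2 : ℝ) • x)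
        (L.comp ((ContinuousLinearMap.id ℝ E).prod (.id ℝ E)) - (2 : ℝ) • .id ℝ E) 0 :=
      (HasFDerivAt.comp (0 : E) (g := fun p : E × E => N (ψ p.1 * ψ p.2))
        (f := fun x : E => (x, x)) hL ((hasFDerivAt_id 0).prodMk (hasFDerivAt_id 0))).sub
        ((hasFDerivAt_id 0).const_smul 2)
    rw [hd.fderiv]
    ext x
    have hx : L (x, x) = L (x, 0) + L (0, x) := by rw [← map_add]; simp
    have h3 : L (x, 0) = x := by simpa using DFunLike.congr_fun hl' x
    have h4 : L (0, x) = x := by simpa using DFunLike.congr_fun hr' x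
    simp [hx, h3, h4, two_smul]
  obtain ⟨CQ, ρQ, hCQ, hρQ, hQ⟩ := hq.exists_norm_sub_le_mul_of_fderiv_eq_zero hq'
  have hsm : ∀ᶠ p : E × E in 𝓝 0, ψ p.1 * ψ p.2 ∈ e.source := by
    refine (hψ1.continuousAt.mul hψ2.continuousAt).eventually_mem ?_
    simpa [hψ0] using e.open_source.mem_nhds h1s
  have hsi : ∀ᶠ p : E × E in 𝓝 0, (ψ p.1)⁻¹ * ψ p.2 ∈ e.source := by
    refine (hψ1.continuousAt.inv.mul hψ2.continuousAt).eventually_mem ?_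
    simpa [hψ0] using e.open_source.mem_nhds h1s
  obtain ⟨r, hr, hball⟩ := Metric.eventually_nhds_iff_ball.1
    (hsm.and (hsi.and (Filter.Eventually.and hsF hsH)))
  refine ⟨N, e.source, min (r / 2) ρQ, KF + KH + CQ, by positivity, by positivity, hN1, h1s,
    ?_, ?_, ?_, ?_⟩
  · intro V hV
    have : ∀ᶠ x in 𝓝 (0 : E), ψ x ∈ V :=
      hψs.continuousAt.eventually_mem (by simpa [hψ0] using hV)
    obtain ⟨t, ht, hb⟩ := Metric.eventually_nhds_iff_ball.1 this
    refine ⟨t / 2, by positivity, fun u hu hut => ?_⟩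
    rw [← hψN u hu]
    exact hb _ (by simpa using hut.trans_lt (half_lt_self ht))
  · intro t ht
    refine Filter.inter_mem (e.open_source.mem_nhds h1s) ?_
    have : ∀ᶠ u in 𝓝 (1 : U), ‖N u‖ < t :=
      (hNc.norm.eventually_lt continuousAt_const (by simpa [hN1] using ht))
    exact this.mono fun u hu => hu.le
  · intro u hu v hv hut hvt
    have hmem : ∀ x y : E, ‖x‖ ≤ min (r / 2) ρQ → ‖y‖ ≤ min (r / 2) ρQ →
        (x, y) ∈ Metric.ball (0 : E × E) r := fun x y hx hy => by
      rw [mem_ball_zero_iff, Prod.norm_mk]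
      exact (max_le (hx.trans (min_le_left _ _)) (hy.trans (min_le_left _ _))).trans_lt
        (half_lt_self hr)
    have h0 : ‖(0 : E)‖ ≤ min (r / 2) ρQ := by simp; constructor <;> positivity
    obtain ⟨ha, hb, hc, hd⟩ := hball _ (hmem _ _ hut hvt)
    -- The Lipschitz bounds are used against `(u, u)`, where the quotient is 1, and `(u, 1)`, where
    -- the product is `u`.
    have hdu := (hball _ (hmem _ _ hut hut)).2.2.2
    have hcu := (hball _ (hmem _ _ hut h0)).2.2.1
    simp only [hψN u hu, hψN v hv] at ha hb
    have e1 := hKH.norm_sub_le hd hdu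
    have e2 := hKF.norm_sub_le hc hcu
    simp only [hψN u hu, hψN v hv, hψ0, inv_mul_cancel, hN1, sub_zero, mul_one, Prod.mk_sub_mk,
      sub_self, Prod.norm_mk, norm_zero, norm_nonneg, sup_of_le_right] at e1 e2
    have e3 : ‖N (u⁻¹ * v)‖ ≤ KH * ‖N u - N v‖ := by rw [norm_sub_rev (N u)]; exact e1
    have hF0 : (0 : ℝ) ≤ KF := KF.2
    have hH0 : (0 : ℝ) ≤ KH := KH.2
    exact ⟨ha, hb, e3.trans (by gcongr; linarith), e2.trans (by gcongr; linarith)⟩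
  · intro t ht u hu v hv hut hvt
    have h := hQ t (ht.trans (min_le_right _ _)) _ _ hut hvt
    have ht0 : 0 ≤ t := (norm_nonneg _).trans hut
    simp only [hψN u hu, hψN v hv] at h
    have hF0 : (0 : ℝ) ≤ KF := KF.2
    have hH0 : (0 : ℝ) ≤ KH := KH.2
    calc _ = ‖N (u * u) - (2 : ℝ) • N u - (N (v * v) - (2 : ℝ) • N v)‖ := by
          rw [smul_sub]; congr 1; abel
      _ ≤ CQ * t * ‖N u - N v‖ := h
      _ ≤ _ := by gcongr; linarith

/-! ### Iterated squaring. -/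

/-- One step of an approximate doubling recursion. -/
lemma norm_sub_two_mul_smul_le {E : Type*} [NormedAddCommGroup E] [NormedSpace ℝ E]
    {x y D : E} {a b C ρ : ℝ} (ha : 0 ≤ a) (hb : 0 ≤ b) (hb1 : b ≤ 1) (hC : 0 ≤ C) (hρ : 0 ≤ ρ)
    (hCρ : 9 / 4 * (C * ρ) ≤ 1) (hyx : ‖y - (2 : ℝ) • x‖ ≤ C * (3 / 2 * (b * ρ)) * ‖x‖)
    (hx : ‖x - a • D‖ ≤ 1 / 2 * b * (a * ‖D‖)) :
    ‖y - (2 * a) • D‖ ≤ 1 / 2 * (2 * b) * (2 * a * ‖D‖) := by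
  have hxn : ‖x‖ ≤ 3 / 2 * (a * ‖D‖) := by
    have h1 : ‖x‖ ≤ ‖x - a • D‖ + ‖a • D‖ := by simpa using norm_add_le (x - a • D) (a • D)
    rw [norm_smul, Real.norm_of_nonneg ha] at h1
    have h2 : 0 ≤ a * ‖D‖ := by positivity
    nlinarith
  have hsplit : y - (2 * a) • D = (y - (2 : ℝ) • x) + (2 : ℝ) • (x - a • D) := by
    rw [smul_sub, smul_smul]; abel
  have h3 : 0 ≤ b * (a * ‖D‖) := by positivity
  calc ‖y - (2 * a) • D‖ ≤ ‖y - (2 : ℝ) • x‖ + 2 * ‖x - a • D‖ := by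
        rw [hsplit]; refine (norm_add_le _ _).trans_eq ?_; rw [norm_smul]; norm_num
    _ ≤ C * (3 / 2 * (b * ρ)) * (3 / 2 * (a * ‖D‖)) + 2 * (1 / 2 * b * (a * ‖D‖)) := by
        gcongr
        exact hyx.trans (by gcongr)
    _ = 9 / 4 * (C * ρ) * (b * (a * ‖D‖)) + b * (a * ‖D‖) := by ring
    _ ≤ 1 * (b * (a * ‖D‖)) + b * (a * ‖D‖) := by gcongr
    _ = 1 / 2 * (2 * b) * (2 * a * ‖D‖) := by ring

section

variable {E U : Type*} [NormedAddCommGroup E] [NormedSpace ℝ E] [Group U]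
  {N : U → E} {W : Set U} {ρ₀ ρ C : ℝ}

/-- If squaring is `x ↦ 2 x + O(x²)` in the coordinate `N`, then raising to the power `2 ^ j` is
close to multiplication by `2 ^ j`, also for differences, as long as the powers stay small. -/
lemma norm_pow_two_pow_sub_le (hρ : 0 ≤ ρ) (hρ₀ : 3 / 2 * ρ ≤ ρ₀) (hC : 0 ≤ C)
    (hCρ : 9 / 4 * (C * ρ) ≤ 1) {k : ℕ}
    (hsq : ∀ t ≤ ρ₀, ∀ u ∈ W, ∀ v ∈ W, ‖N u‖ ≤ t → ‖N v‖ ≤ t →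
      ‖N (u * u) - N (v * v) - (2 : ℝ) • (N u - N v)‖ ≤ C * t * ‖N u - N v‖)
    {u v : U} {l : ℕ} (hl : l ≤ k)
    (hu : ∀ j < l, u ^ 2 ^ j ∈ W ∧ ‖N (u ^ 2 ^ j)‖ ≤ 3 / 2 * (2 ^ j / 2 ^ k * ρ))
    (hv : ∀ j < l, v ^ 2 ^ j ∈ W ∧ ‖N (v ^ 2 ^ j)‖ ≤ 3 / 2 * (2 ^ j / 2 ^ k * ρ)) :
    ‖N (u ^ 2 ^ l) - N (v ^ 2 ^ l) - (2 ^ l : ℝ) • (N u - N v)‖ ≤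
      1 / 2 * (2 ^ l / 2 ^ k) * (2 ^ l * ‖N u - N v‖) := by
  -- Squaring has relative error proportional to the current size, which roughly doubles each time;
  -- the geometric sum stays below 1/2 up to `l = k`.
  induction l with
  | zero =>
    simp only [pow_zero, pow_one, one_smul, sub_self, norm_zero]
    positivity
  | succ l ih =>
    have ih' := ih (by omega) (fun j hj => hu j (by omega)) (fun j hj => hv j (by omega))
    obtain ⟨hu1, hu2⟩ := hu l (by omega)
    obtain ⟨hv1, hv2⟩ := hv l (by omega)
    have hb1 : (2 : ℝ) ^ l / 2 ^ k ≤ 1 :=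
      div_le_one_of_le₀ (pow_le_pow_right₀ (by norm_num) (by omega)) (by positivity)
    have hstep := hsq (3 / 2 * (2 ^ l / 2 ^ k * ρ)) (by nlinarith) _ hu1 _ hv1 hu2 hv2
    rw [← pow_two, ← pow_two, ← pow_mul, ← pow_mul, ← pow_succ] at hstep
    have := norm_sub_two_mul_smul_le (by positivity) (by positivity) hb1 hC hρ hCρ hstep ih'
    rw [pow_succ' (2 : ℝ) l, mul_div_assoc]
    exact this

/-- The powers `u ^ 2 ^ j` of an element of size `ρ / 2 ^ k` stay small for `j ≤ k`. -/
lemma pow_two_pow_mem_and_norm_le (hρ : 0 ≤ ρ) (hρ₀ : 3 / 2 * ρ ≤ ρ₀) (hC : 0 ≤ C)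
    (hCρ : 9 / 4 * (C * ρ) ≤ 1) (hN : N 1 = 0) (hW : 1 ∈ W)
    (hmul : ∀ u ∈ W, ‖N u‖ ≤ ρ₀ → u * u ∈ W)
    (hsq : ∀ t ≤ ρ₀, ∀ u ∈ W, ∀ v ∈ W, ‖N u‖ ≤ t → ‖N v‖ ≤ t →
      ‖N (u * u) - N (v * v) - (2 : ℝ) • (N u - N v)‖ ≤ C * t * ‖N u - N v‖)
    {k : ℕ} {u : U} (hu : u ∈ W) (huk : ‖N u‖ ≤ ρ / 2 ^ k) {j : ℕ} (hj : j ≤ k) :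
    u ^ 2 ^ j ∈ W ∧ ‖N (u ^ 2 ^ j)‖ ≤ 3 / 2 * (2 ^ j / 2 ^ k * ρ) := by
  induction j using Nat.strong_induction_on with
  | _ j ih =>
  have hb1 : ∀ {i : ℕ}, i ≤ k → (2 : ℝ) ^ i / 2 ^ k ≤ 1 := fun h =>
    div_le_one_of_le₀ (pow_le_pow_right₀ (by norm_num) h) (by positivity)
  -- Comparison with `v = 1` at exponent `j` needs size bounds only for smaller exponents; relative
  -- error 1/2 gives the factor 3/2.
  have h := norm_pow_two_pow_sub_le hρ hρ₀ hC hCρ hsq hj (fun i hi => ih i hi (by omega))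
    (v := 1) (fun i hi => ⟨by simpa using hW, by simp [hN]; positivity⟩)
  simp only [one_pow, hN, sub_zero] at h
  refine ⟨?_, ?_⟩
  · cases j with
    | zero => simpa using hu
    | succ i =>
      obtain ⟨h1, h2⟩ := ih i (by omega) (by omega)
      rw [pow_succ 2 i, pow_mul, pow_two]
      exact hmul _ h1 (h2.trans (by nlinarith [hb1 (i := i) (by omega)]))
  · have h1 : ‖N (u ^ 2 ^ j)‖ ≤ ‖N (u ^ 2 ^ j) - (2 ^ j : ℝ) • N u‖ + ‖(2 ^ j : ℝ) • N u‖ := by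
      simpa using norm_add_le (N (u ^ 2 ^ j) - (2 ^ j : ℝ) • N u) ((2 ^ j : ℝ) • N u)
    rw [norm_smul, norm_pow, Real.norm_ofNat] at h1
    have h2 : 0 ≤ 2 ^ j * ‖N u‖ := by positivity
    calc ‖N (u ^ 2 ^ j)‖ ≤ 3 / 2 * (2 ^ j * ‖N u‖) := by nlinarith [hb1 hj]
      _ ≤ 3 / 2 * (2 ^ j * (ρ / 2 ^ k)) := by gcongr
      _ = _ := by ring

/-- Distances grow at least by the factor `2 ^ (k - 1)` under the power map of exponent `2 ^ k`
on the ball of radius `ρ / 2 ^ k`. -/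
lemma two_pow_mul_norm_sub_le (hρ : 0 ≤ ρ) (hρ₀ : 3 / 2 * ρ ≤ ρ₀) (hC : 0 ≤ C)
    (hCρ : 9 / 4 * (C * ρ) ≤ 1) (hN : N 1 = 0) (hW : 1 ∈ W)
    (hmul : ∀ u ∈ W, ‖N u‖ ≤ ρ₀ → u * u ∈ W)
    (hsq : ∀ t ≤ ρ₀, ∀ u ∈ W, ∀ v ∈ W, ‖N u‖ ≤ t → ‖N v‖ ≤ t →
      ‖N (u * u) - N (v * v) - (2 : ℝ) • (N u - N v)‖ ≤ C * t * ‖N u - N v‖)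
    {k : ℕ} {u v : U} (hu : u ∈ W) (huk : ‖N u‖ ≤ ρ / 2 ^ k) (hv : v ∈ W)
    (hvk : ‖N v‖ ≤ ρ / 2 ^ k) :
    2 ^ k * ‖N u - N v‖ ≤ 2 * ‖N (u ^ 2 ^ k) - N (v ^ 2 ^ k)‖ := by
  have h := norm_pow_two_pow_sub_le hρ hρ₀ hC hCρ hsq le_rfl
    (fun i hi => pow_two_pow_mem_and_norm_le hρ hρ₀ hC hCρ hN hW hmul hsq hu huk hi.le)
    (fun i hi => pow_two_pow_mem_and_norm_le hρ hρ₀ hC hCρ hN hW hmul hsq hv hvk hi.le)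
  rw [div_self (by positivity), norm_sub_rev] at h
  have h1 := norm_sub_norm_le ((2 ^ k : ℝ) • (N u - N v)) (N (u ^ 2 ^ k) - N (v ^ 2 ^ k))
  rw [norm_smul, norm_pow, Real.norm_ofNat] at h1
  linarith

end

/-! ### Finiteness of discrete subgroups. -/

/-- A set is finite if it is coloured with finitely many colours and the quotients of elements of
equal colour range in a finite set. -/
lemma Set.Finite.of_coloring {U κ : Type*} [Group U] {A T : Set U} {F : Set κ} (hF : F.Finite)
    (hT : T.Finite) (g : U → κ) (hgF : ∀ x ∈ A, g x ∈ F)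
    (hg : ∀ x ∈ A, ∀ y ∈ A, g x = g y → x⁻¹ * y ∈ T) : A.Finite := by
  refine Set.Finite.of_finite_fibers g (hF.subset (Set.image_subset_iff.2 hgF)) fun i _ => ?_
  rcases (A ∩ g ⁻¹' {i}).eq_empty_or_nonempty with h | ⟨x, hxA, hx⟩
  · simp [h]
  · refine (hT.image (x * ·)).subset fun y hy => ⟨x⁻¹ * y, hg x hxA y hy.1 ?_, by simp⟩
    exact hx.trans hy.2.symm

/-- A discrete subgroup of a Banach Lie group covered by finitely many left translates of a
sufficiently small neighbourhood of the identity is finite. -/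
lemma LieGroup.exists_nhds_finite_of_discrete
    {E : Type*} [NormedAddCommGroup E] [NormedSpace ℝ E]
    {U : Type*} [Group U] [TopologicalSpace U] [ChartedSpace E U] [LieGroup 𝓘(ℝ, E) 2 U] :
    ∃ V ∈ 𝓝 (1 : U), ∀ K : Subgroup U, DiscreteTopology K → ∀ F : Set U, F.Finite →
      (∀ a ∈ K, ∃ x ∈ F, x⁻¹ * a ∈ V) → (K : Set U).Finite := by
  have : IsTopologicalGroup U := topologicalGroup_of_lieGroup 𝓘(ℝ, E) 2
  obtain ⟨N, W, ρ₀, C, hρ₀, hC, hN, hW, hbasis, hnhds, hgrp, hsq⟩ :=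
    LieGroup.exists_chart_estimates (E := E) (U := U)
  obtain ⟨ρ, hρ, hρρ₀, hCρ⟩ : ∃ ρ : ℝ, 0 < ρ ∧ 3 / 2 * ρ ≤ ρ₀ ∧ 9 / 4 * (C * ρ) ≤ 1 := by
    refine ⟨min (2 / 3 * ρ₀) (4 / 9 / C), by positivity, ?_, ?_⟩
    · linarith [min_le_left (2 / 3 * ρ₀) (4 / 9 / C)]
    · have := (le_div_iff₀ hC).1 (min_le_right (2 / 3 * ρ₀) (4 / 9 / C))
      linarith
  have hmul : ∀ u ∈ W, ‖N u‖ ≤ ρ₀ → u * u ∈ W := fun u hu h => (hgrp u hu u hu h h).1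
  -- Two Lipschitz factors `C`, a 2 from the expansion bound and a 2 from passing to `k + 1` give `4
  -- * C ^ 2`.
  set σ : ℝ := min ρ (ρ / (4 * C ^ 2)) with hσ
  have hσ0 : 0 < σ := by positivity
  have hσρ : σ ≤ ρ := min_le_left _ _
  have hσC : 4 * C ^ 2 * σ ≤ ρ := by
    have := (le_div_iff₀ (by positivity)).1 (min_le_right ρ (ρ / (4 * C ^ 2)))
    linarith
  have hdiv : ∀ᶠ p : U × U in 𝓝 1 ×ˢ 𝓝 1, p.1⁻¹ * p.2 ∈ {u | u ∈ W ∧ ‖N u‖ ≤ σ} := by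
    rw [← nhds_prod_eq]
    exact ContinuousAt.eventually_mem (f := fun p : U × U => p.1⁻¹ * p.2) (by fun_prop)
      (by simpa using hnhds σ hσ0)
  obtain ⟨V, hV, hVdiv⟩ := Filter.eventually_prod_self_iff'.1 hdiv
  refine ⟨V, hV, fun K hK F hF hcov => ?_⟩
  choose! c hcF hcV using hcov
  have hcol : ∀ a ∈ K, ∀ b ∈ K, c a = c b → a⁻¹ * b ∈ W ∧ ‖N (a⁻¹ * b)‖ ≤ σ := by
    intro a ha b hb hab
    have h1 := hVdiv _ (hcV a ha) _ (hcV b hb)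
    simpa [hab, mul_assoc] using h1
  set S : ℕ → Set U := fun k => {u | u ∈ K ∧ u ∈ W ∧ ‖N u‖ ≤ ρ / 2 ^ k} with hS
  have hdesc : ∀ k, (S (k + 1)).Finite → (S k).Finite := by
    intro k hk
    refine hF.of_coloring hk (fun u => c (u ^ 2 ^ k)) (fun u hu => hcF _ (K.pow_mem hu.1 _)) ?_
    rintro u ⟨huK, huW, huk⟩ v ⟨hvK, hvW, hvk⟩ huv
    have hle : ρ / 2 ^ k ≤ ρ₀ :=
      (div_le_self hρ.le (one_le_pow₀ (by norm_num))).trans (by linarith)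
    obtain ⟨-, hW', hquot, -⟩ := hgrp u huW v hvW (huk.trans hle) (hvk.trans hle)
    refine ⟨K.mul_mem (K.inv_mem huK) hvK, hW', ?_⟩
    obtain ⟨hw, hwσ⟩ := hcol _ (K.pow_mem huK _) _ (K.pow_mem hvK _) huv
    obtain ⟨hpW, hp⟩ :=
      pow_two_pow_mem_and_norm_le hρ.le hρρ₀ hC.le hCρ hN hW hmul hsq huW huk le_rfl
    rw [div_self (by positivity), one_mul] at hp
    have hclose := (hgrp _ hpW _ hw (hp.trans hρρ₀) (by linarith)).2.2.2
    rw [mul_inv_cancel_left, norm_sub_rev] at hclose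
    have hexp := two_pow_mul_norm_sub_le hρ.le hρρ₀ hC.le hCρ hN hW hmul hsq huW huk hvW hvk
    rw [le_div_iff₀ (by positivity), pow_succ]
    calc ‖N (u⁻¹ * v)‖ * (2 ^ k * 2) ≤ C * ‖N u - N v‖ * (2 ^ k * 2) := by gcongr
      _ = 2 * C * (2 ^ k * ‖N u - N v‖) := by ring
      _ ≤ 2 * C * (2 * (C * σ)) := by
        refine mul_le_mul_of_nonneg_left (hexp.trans ?_) (by positivity)
        exact mul_le_mul_of_nonneg_left (hclose.trans (by gcongr)) (by norm_num)
      _ = 4 * C ^ 2 * σ := by ring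
      _ ≤ ρ := hσC
  have hbig : ∃ k, (S k).Finite := by
    obtain ⟨O, hO, hOK⟩ : ∃ O ∈ 𝓝 (1 : U), ∀ u ∈ O, u ∈ K → u = 1 := by
      have h1 : ({1} : Set K) ∈ 𝓝 (1 : K) := by simp
      obtain ⟨O, hO, hsub⟩ := (mem_nhds_subtype _ _ _).1 h1
      exact ⟨O, hO, fun u hu huK => congrArg Subtype.val (hsub (a := ⟨u, huK⟩) hu)⟩
    obtain ⟨t, ht, hb⟩ := hbasis O hO
    obtain ⟨k, hk⟩ := exists_pow_lt_of_lt_one (div_pos ht hρ) (y := (1 / 2 : ℝ)) (by norm_num)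
    refine ⟨k, (Set.finite_singleton 1).subset fun u hu => hOK u (hb u hu.2.1 ?_) hu.1⟩
    rw [lt_div_iff₀ hρ, one_div, inv_pow] at hk
    refine hu.2.2.trans (le_trans (le_of_eq ?_) hk.le)
    rw [div_eq_inv_mul]
  obtain ⟨k, hk⟩ := hbig
  have hS0 : (S 0).Finite := by
    induction k with
    | zero => exact hk
    | succ k ih => exact ih (hdesc k hk)
  refine hF.of_coloring hS0 c hcF fun x hx y hy hxy => ?_
  obtain ⟨h1, h2⟩ := hcol x hx y hy hxy
  exact ⟨K.mul_mem (K.inv_mem hx) hy, h1, by simpa using h2.trans hσρ⟩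

theorem mainTheorem10
    {E : Type*} [NormedAddCommGroup E] [NormedSpace ℝ E] [CompleteSpace E]
    {U : Type*} [Group U] [MetricSpace U] [ChartedSpace E U] [LieGroup 𝓘(ℝ, E) ω U]
    (G : Subgroup U) (hG : IsCompact (G : Set U)) :
    ∃ ε₀ : ℝ, 0 < ε₀ ∧ ∀ ε : ℝ, 0 < ε → ε ≤ ε₀ →
      ∀ K : Subgroup U, DiscreteTopology K → IsClosed (K : Set U) →
        (K : Set U) ⊆ Metric.thickening ε (G : Set U) → (K : Set U).Finite := by
  -- Second-order smoothness suffices for the quadratic error in squaring.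
  have : LieGroup 𝓘(ℝ, E) 2 U := LieGroup.of_le (n := ω) le_top
  have : IsTopologicalGroup U := topologicalGroup_of_lieGroup 𝓘(ℝ, E) 2
  obtain ⟨V, hV, hfin⟩ := LieGroup.exists_nhds_finite_of_discrete (E := E) (U := U)
  have hnhds : ∀ x : U, (fun y => x⁻¹ * y) ⁻¹' interior V ∈ 𝓝 x := fun x =>
    (continuous_const_mul x⁻¹).continuousAt.preimage_mem_nhds (by
      simpa using interior_mem_nhds.2 hV)
  obtain ⟨F, -, hF⟩ := hG.elim_nhds_subcover _ fun x _ => hnhds x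
  obtain ⟨ε₀, hε₀, hsub⟩ := hG.exists_thickening_subset_open
    (isOpen_biUnion fun x _ => isOpen_interior.preimage (continuous_const_mul x⁻¹)) hF
  refine ⟨ε₀, hε₀, fun ε _ hε K hK _ hKG => hfin K hK F F.finite_toSet fun a ha => ?_⟩
  obtain ⟨x, hx, hax⟩ := Set.mem_iUnion₂.1 (hsub (Metric.thickening_mono hε _ (hKG ha)))
  exact ⟨x, hx, interior_subset hax⟩
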